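/- Let $M$ be a smooth ($C^\infty$, Hausdorff, boundaryless) real manifold of dimension $n$, let $J$ be a smooth almost complex structure on $M$ (a smooth $(1,1)$-tensor field with $J^2=-\mathrm{Id}$; so $n$ is even if $M\neq\emptyset$), and let $\nabla$ be a smooth connection on $TM$ with torsion $T$. Let $\pi:T^*M\to M$ be the projection and, for $\xi\in T^*M$ with $\pi(\xi)=x$, regard $T_x^*M\subseteq T_\xi T^*M$ as the vertical space. With the induced connection $(\nabla_Xs)(Y)=X.s(Y)-s(\nabla_XY)$ on one-forms, put $$H^\nabla_\xi=\{d_xs(X): X\in T_xM,\ s \text{ a smooth one-form},\ s(x)=\xi,\ \nabla_Xs=0\}.$$ The generalized horizontal lift $J^{G,\nabla}$ is the field of endomorphisms of the spaces $T_\xi T^*M=H^\nabla_\xi\oplus T^*_xM$ given by $J^{G,\nabla}(h+\alpha)=h'+\alpha\circ J$ for $h\in H^\nabla_\xi$, $\alpha\in T_x^*M$, where $h'\in H^\nabla_\xi$ is the vector with $d_\xi\pi(h')=J\,d_\xi\pi(h)$. Let $\theta$ be the Liouville form, $\theta_\xi(Y)=\xi(d_\xi\pi(Y))$, let $\omega_{st}=d\theta$,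 and let $\theta(J)$ be the one-form on $T^*M$ with $\theta(J)_\xi(Y)=\xi(J\,d_\xi\pi(Y))$. The complete lift $J^c$ is the field of endomorphisms of the tangent spaces of $T^*M$ defined by $d(\theta(J))=\omega_{st}(J^c\cdot,\cdot)$. For a $(1,2)$-tensor field $R=R^k_{i,j}\,dx^i\otimes dx^j\otimes\partial x_k$ on $M$, let $\gamma(R)=p_kR^k_{i,j}\,dx^i\otimes\partial p_j$, i.e. $\gamma(R)_\xi(Y)$ is the vertical vector $\xi(R(d_\xi\pi(Y),\cdot))$. Finally let $(\nabla J)(X,Y)=\nabla_X(JY)-J\nabla_XY$ and let $S$ be the $(1,2)$-tensor field $$S(X,Y)=-(\nabla J)(X,Y)+(\nabla J)(Y,X)+T(JX,Y)-JT(X,Y).$$ Then the definitions of $J^{G,\nabla}$ and of $J^c$ each determine exactly one field of endomorphisms of the tangent spaces of $T^*M$, and: (1) For every smooth chart $(x_1,\dots,x_n)$ of $M$, with $J\partial x_j=J^i_j\,\partial x_i$, $\nabla_{\partial x_i}\partial x_j=\Gamma^k_{i,j}\,\partial x_k$, the associated local coordinates $(x_1,\dots,x_n,p_1,\dots,p_n)$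 of $T^*M$ (where $\xi=p_i\,dx^i$) and $\Gamma_{i,j}=p_k\Gamma^k_{i,j}$ (repeated indices are summed over), the matrix of $J^{G,\nabla}$ in the basis $\partial x_1,\dots,\partial x_n,\partial p_1,\dots,\partial p_n$ is $$J^{G,\nabla}=\begin{pmatrix}J^i_j&0\\ \Gamma_{l,i}J^l_j-\Gamma_{j,l}J^l_i&J^j_i\end{pmatrix},$$ where $i$ is the row index and $j$ the column index of each block. (2) $J^{G,\nabla}=J^c+\gamma(S)$. -/

import Mathlib

open Bundle Set
open scoped Manifold ContDiff Topology

noncomputable section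

namespace CotangentLift

/-- The Euclidean space `ℝⁿ` on which an `n`-dimensional manifold is modelled. -/
abbrev Model (n : ℕ) : Type := EuclideanSpace ℝ (Fin n)

section Basic

variable {n : ℕ} {M : Type*} [TopologicalSpace M] [ChartedSpace (Model n) M]

/-- The cotangent space `T_x^* M`. -/
abbrev CotangentSpace (x : M) : Type :=
  TangentSpace (𝓡 n) x →L[ℝ] Bundle.Trivial M ℝ x

variable [IsManifold (𝓡 n) ∞ M]

variable (n M) in
/-- The total space `T^* M` of the cotangent bundle, with Mathlib's topology and smooth structure
of a bundle of continuous linear maps. -/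
abbrev CotangentBundle : Type _ :=
  TotalSpace (Model n →L[ℝ] ℝ) (fun x : M => CotangentSpace (n := n) x)

variable (n) in
/-- The model with corners of the manifold `T^* M`. -/
abbrev cotModel : ModelWithCorners ℝ (Model n × (Model n →L[ℝ] ℝ))
    (ModelProd (Model n) (Model n →L[ℝ] ℝ)) :=
  (𝓡 n).prod 𝓘(ℝ, Model n →L[ℝ] ℝ)

/-- The space `T_ξ T^* M`. -/
abbrev TT (ξ : CotangentBundle n M) : Type :=
  TangentSpace (cotModel n) ξ

/-- The differential `d_ξ π : T_ξ T^* M → T_x M` of the projection `π : T^* M → M`, with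
`x = π ξ`. -/
def dproj (ξ : CotangentBundle n M) : TT ξ →L[ℝ] TangentSpace (𝓡 n) ξ.proj :=
  mfderiv (cotModel n) (𝓡 n) (fun η : CotangentBundle n M => η.proj) ξ

/-- The canonical inclusion `T_x^* M → T_ξ T^* M` of the vertical space: the differential at `ξ` of
the inclusion of the fibre `T_x^* M` in `T^* M`, where `x = π ξ`. -/
def vertical (ξ : CotangentBundle n M) : CotangentSpace (n := n) ξ.proj →L[ℝ] TT ξ :=
  mfderiv 𝓘(ℝ, Model n →L[ℝ] ℝ) (cotModel n)
    (fun α : Model n →L[ℝ] ℝ => (⟨ξ.proj, α⟩ : CotangentBundle n M)) ξ.snd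

/-- The smooth vector fields on `M`. -/
def SmoothVectorField (X : Π x : M, TangentSpace (𝓡 n) x) : Prop :=
  ContMDiff (𝓡 n) ((𝓡 n).prod 𝓘(ℝ, Model n)) ∞
    (fun x => (⟨x, X x⟩ : TotalSpace (Model n) (fun x : M => TangentSpace (𝓡 n) x)))

/-- The smooth one-forms on `M`, i.e. the smooth sections of `T^* M`. -/
def SmoothOneForm (s : Π x : M, CotangentSpace (n := n) x) : Prop :=
  ContMDiff (𝓡 n) (cotModel n) ∞ (fun x => (⟨x, s x⟩ : CotangentBundle n M))

variable (n M) in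
/-- An almost complex structure on `M`: a smooth field `J` of endomorphisms of the tangent spaces
with `J² = -Id`. -/
structure AlmostComplexStructure where
  /-- the endomorphism `J x` of `T_x M` -/
  toFun : Π x : M, TangentSpace (𝓡 n) x →L[ℝ] TangentSpace (𝓡 n) x
  contMDiff : ContMDiff (𝓡 n) ((𝓡 n).prod 𝓘(ℝ, Model n →L[ℝ] Model n)) ∞
    (fun x => (⟨x, toFun x⟩ : TotalSpace (Model n →L[ℝ] Model n)
      (fun x : M => TangentSpace (𝓡 n) x →L[ℝ] TangentSpace (𝓡 n) x)))
  sq : ∀ (x : M) (v : TangentSpace (𝓡 n) x), toFun x (toFun x v) = -v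

instance : CoeFun (AlmostComplexStructure n M)
    (fun _ => Π x : M, TangentSpace (𝓡 n) x →L[ℝ] TangentSpace (𝓡 n) x) :=
  ⟨AlmostComplexStructure.toFun⟩

variable (n M) in
/-- A connection on `M`, i.e. a covariant derivative on `TM`. In Mathlib's convention
`cov Y x (X x)` is the value at `x` of `∇_X Y`. -/
abbrev Connection : Type _ :=
  CovariantDerivative (𝓡 n) (Model n) (fun x : M => TangentSpace (𝓡 n) x)

/-! ### The horizontal distribution and the generalized horizontal lift -/

/-- The value at `x` of `(∇_X s)(Y) = X.s(Y) - s(∇_X Y)`, where `∇` is the induced connection on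
the cotangent bundle; it depends on the vector field `X` only through its value `X` at `x`. -/
def dualDeriv (cov : Connection n M) {x : M} (X : TangentSpace (𝓡 n) x)
    (s : Π y : M, CotangentSpace (n := n) y) (Y : Π y : M, TangentSpace (𝓡 n) y) : ℝ :=
  mvfderiv (𝓡 n) (fun y : M => (s y (Y y) : ℝ)) x X - (s x (cov Y x X) : ℝ)

/-- The horizontal distribution `H^∇_ξ = {d_x s(X) : X ∈ T_x M, s(x) = ξ, ∇_X s = 0}`. -/
def horizontal (cov : Connection n M) (ξ : CotangentBundle n M) : Set (TT ξ) :=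
  {Y | ∃ (X : TangentSpace (𝓡 n) ξ.proj) (s : Π x : M, CotangentSpace (n := n) x),
    SmoothOneForm s ∧ s ξ.proj = ξ.snd ∧
    (∀ Z : Π x : M, TangentSpace (𝓡 n) x, SmoothVectorField Z → dualDeriv cov X s Z = 0) ∧
    Y = mfderiv (𝓡 n) (cotModel n) (fun x => (⟨x, s x⟩ : CotangentBundle n M)) ξ.proj X}

variable (n M) in
/-- Fields of endomorphisms of the tangent spaces of `T^* M`. -/
abbrev EndField : Type _ := Π ξ : CotangentBundle n M, TT ξ →L[ℝ] TT ξ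

/-- `A` is the product structure `J ⊕ ᵗJ` with respect to the decomposition
`T_ξ T^* M = H^∇_ξ ⊕ T_x^* M`: it maps `h + α`, with `h` horizontal and `α` vertical, to
`h' + α ∘ J`, where `h'` is the horizontal vector with `dπ h' = J (dπ h)`. -/
def IsGeneralizedHorizontalLift (J : AlmostComplexStructure n M) (cov : Connection n M)
    (A : EndField n M) : Prop :=
  ∀ ξ : CotangentBundle n M, ∀ h ∈ horizontal cov ξ, ∀ h' ∈ horizontal cov ξ,
    dproj ξ h' = J ξ.proj (dproj ξ h) →
    ∀ α : CotangentSpace (n := n) ξ.proj,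
      A ξ (h + vertical ξ α) = h' + vertical ξ (α.comp (J ξ.proj))

/-- The generalized horizontal lift `J^{G,∇}`. -/
def generalizedHorizontalLift (J : AlmostComplexStructure n M) (cov : Connection n M) :
    EndField n M :=
  Classical.epsilon (IsGeneralizedHorizontalLift J cov)

/-! ### The Liouville form, the canonical symplectic form and the complete lift -/

variable (n M) in
/-- One-forms on `T^* M`. -/
abbrev OneForm : Type _ := Π ξ : CotangentBundle n M, TT ξ →L[ℝ] ℝ

/-- The expression `Σ_a β_a dz^a` of a one-form `β` on `T^* M` in the preferred chart at `ξ`. -/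
def OneForm.inChart (β : OneForm n M) (ξ : CotangentBundle n M)
    (z : Model n × (Model n →L[ℝ] ℝ)) : (Model n × (Model n →L[ℝ] ℝ)) →L[ℝ] ℝ :=
  (β ((extChartAt (cotModel n) ξ).symm z)).comp
    (mfderiv 𝓘(ℝ, Model n × (Model n →L[ℝ] ℝ)) (cotModel n) (extChartAt (cotModel n) ξ).symm z)

/-- The exterior derivative `(dβ)_ξ(Y, Z)` of a one-form on `T^* M`. In a chart with coordinates
`z^a` it is `Σ_{a,b} ∂_a β_b (Y^a Z^b - Z^a Y^b)`. -/
def OneForm.d (β : OneForm n M) (ξ : CotangentBundle n M) (Y Z : TT ξ) : ℝ :=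
  let φ := extChartAt (cotModel n) ξ
  let dφ : TT ξ →L[ℝ] Model n × (Model n →L[ℝ] ℝ) :=
    mvfderiv (cotModel n) φ ξ
  fderiv ℝ (β.inChart ξ) (φ ξ) (dφ Y) (dφ Z) - fderiv ℝ (β.inChart ξ) (φ ξ) (dφ Z) (dφ Y)

variable (n M) in
/-- The Liouville form `θ = p_i dx^i`, that is `θ_ξ(Y) = ξ(dπ Y)`. -/
def liouville : OneForm n M := fun ξ => ContinuousLinearMap.comp ξ.snd (dproj ξ)

/-- The canonical symplectic form `ω_st = dθ`. -/
def omegaSt (ξ : CotangentBundle n M) (Y Z : TT ξ) : ℝ := (liouville n M).d ξ Y Z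

/-- The one-form `θ(J) = p_k J^k_l dx^l`, that is `θ(J)_ξ(Y) = ξ(J dπ Y)`. -/
def thetaJ (J : AlmostComplexStructure n M) : OneForm n M :=
  fun ξ => (ContinuousLinearMap.comp ξ.snd (J ξ.proj)).comp (dproj ξ)

/-- The identity `d(θ(J)) = ω_st(A · , ·)` which defines the complete lift. -/
def IsCompleteLift (J : AlmostComplexStructure n M) (A : EndField n M) : Prop :=
  ∀ (ξ : CotangentBundle n M) (Y Z : TT ξ), (thetaJ J).d ξ Y Z = omegaSt ξ (A ξ Y) Z

/-- The complete lift `J^c`. -/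
def completeLift (J : AlmostComplexStructure n M) : EndField n M :=
  Classical.epsilon (IsCompleteLift J)

/-! ### The contraction `γ` and the tensor `S` -/

/-- The contraction `γ(R) = p_k R^k_{i,j} dx^i ⊗ ∂p_j` of a tensor `R` of type `(1,2)` on `M`:
it maps `Y ∈ T_ξ T^* M` to the vertical vector given by the covector `ξ(R(dπ Y, · ))`. -/
def gammaContraction
    (R : Π x : M, TangentSpace (𝓡 n) x →L[ℝ] TangentSpace (𝓡 n) x →L[ℝ] TangentSpace (𝓡 n) x) :
    EndField n M :=
  fun ξ => (vertical ξ).comp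
    ((ContinuousLinearMap.postcomp (TangentSpace (𝓡 n) ξ.proj) ξ.snd).comp
      ((R ξ.proj).comp (dproj ξ)))

/-- `(∇J)(X, Y) = ∇_X (JY) - J ∇_X Y`, for vector fields `X` and `Y`. -/
def nablaJ (J : AlmostComplexStructure n M) (cov : Connection n M)
    (X Y : Π x : M, TangentSpace (𝓡 n) x) : Π x : M, TangentSpace (𝓡 n) x :=
  fun x => cov (fun y => J y (Y y)) x (X x) - J x (cov Y x (X x))

/-- `S(X, Y) = -(∇J)(X, Y) + (∇J)(Y, X) + T(JX, Y) - J T(X, Y)`, for vector fields `X` and `Y`,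
where `T` is the torsion of `∇`. -/
def SField (J : AlmostComplexStructure n M) (cov : Connection n M)
    (X Y : Π x : M, TangentSpace (𝓡 n) x) : Π x : M, TangentSpace (𝓡 n) x :=
  fun x => -(nablaJ J cov X Y x) + nablaJ J cov Y X x
    + cov.torsion x (J x (X x)) (Y x) - J x (cov.torsion x (X x) (Y x))

lemma AlmostComplexStructure.mdifferentiableAt_apply (J : AlmostComplexStructure n M) {x : M}
    {Y : Π x : M, TangentSpace (𝓡 n) x}
    (hY : MDifferentiableAt (𝓡 n) ((𝓡 n).prod 𝓘(ℝ, Model n))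
      (fun y => (⟨y, Y y⟩ : TotalSpace (Model n) (fun x : M => TangentSpace (𝓡 n) x))) x) :
    MDifferentiableAt (𝓡 n) ((𝓡 n).prod 𝓘(ℝ, Model n))
      (fun y => (⟨y, J y (Y y)⟩ : TotalSpace (Model n) (fun x : M => TangentSpace (𝓡 n) x))) x :=
  MDifferentiableAt.clm_bundle_apply (J.contMDiff.mdifferentiable (by simp) x) hY

lemma nablaJ_tensorial (J : AlmostComplexStructure n M) (cov : Connection n M)
    (X : Π x : M, TangentSpace (𝓡 n) x) (x : M) :
    TensorialAt (𝓡 n) (Model n) (fun Y => nablaJ J cov X Y x) x where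
  smul {f σ} hf hσ := by
    have h1 := cov.isCovariantDerivativeOnUniv.leibniz (J.mdifferentiableAt_apply hσ) hf
    have h2 := cov.isCovariantDerivativeOnUniv.leibniz hσ hf
    have e : (fun y => J y ((f • σ) y)) = f • (fun y => J y (σ y)) := by
      ext1 y; simp
    simp only [nablaJ, e, h1, h2]
    simp
    module
  add {σ σ'} hσ hσ' := by
    have h1 := cov.isCovariantDerivativeOnUniv.add (J.mdifferentiableAt_apply hσ)
      (J.mdifferentiableAt_apply hσ')
    have h2 := cov.isCovariantDerivativeOnUniv.add hσ hσ'
    have e : (fun y => J y ((σ + σ') y)) = (fun y => J y (σ y)) + (fun y => J y (σ' y)) := by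
      ext1 y; simp
    simp only [nablaJ, e, h1, h2]
    simp
    module

lemma SField_tensorial_left (J : AlmostComplexStructure n M) (cov : Connection n M)
    (Y : Π x : M, TangentSpace (𝓡 n) x) (x : M) :
    TensorialAt (𝓡 n) (Model n) (fun X => SField J cov X Y x) x where
  smul {f σ} hf hσ := by
    have h := (nablaJ_tensorial J cov Y x).smul hf hσ
    simp only [SField, h]
    simp [nablaJ]
    module
  add {σ σ'} hσ hσ' := by
    have h := (nablaJ_tensorial J cov Y x).add hσ hσ'
    simp only [SField, h]
    simp [nablaJ]
    module

lemma SField_tensorial_right (J : AlmostComplexStructure n M) (cov : Connection n M)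
    (X : Π x : M, TangentSpace (𝓡 n) x) (x : M) :
    TensorialAt (𝓡 n) (Model n) (fun Y => SField J cov X Y x) x where
  smul {f σ} hf hσ := by
    have h := (nablaJ_tensorial J cov X x).smul hf hσ
    simp only [SField, h]
    simp [nablaJ]
    module
  add {σ σ'} hσ hσ' := by
    have h := (nablaJ_tensorial J cov X x).add hσ hσ'
    simp only [SField, h]
    simp [nablaJ]
    module

/-- The tensor `S` of type `(1,2)` on `M` whose values on vector fields are given by `SField`. -/
def tensorS (J : AlmostComplexStructure n M) (cov : Connection n M) (x : M) :
    TangentSpace (𝓡 n) x →L[ℝ] TangentSpace (𝓡 n) x →L[ℝ] TangentSpace (𝓡 n) x :=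
  TensorialAt.mkHom₂ (fun X Y => SField J cov X Y x) x
    (fun Y _ => SField_tensorial_left J cov Y x) (fun X _ => SField_tensorial_right J cov X x)

/-! ### Local coordinates -/

/-- The coordinate vector field `∂x_i` of a chart `φ = (x_1, …, x_n)` of `M` (relevant on the
domain of `φ`). -/
def coordVector (φ : OpenPartialHomeomorph M (Model n)) (i : Fin n) (x : M) :
    TangentSpace (𝓡 n) x :=
  (mvfderiv (𝓡 n) φ x).inverse (EuclideanSpace.single i (1 : ℝ))

/-- The coordinate covector `dx^i` at `x`. -/
def coordCovector (φ : OpenPartialHomeomorph M (Model n)) (i : Fin n) (x : M) :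
    TangentSpace (𝓡 n) x →L[ℝ] ℝ :=
  (EuclideanSpace.proj i : Model n →L[ℝ] ℝ).comp (mvfderiv (𝓡 n) φ x)

/-- The component `J^i_j` of `J`, defined by `J ∂x_j = J^i_j ∂x_i`. -/
def JCoeff (J : AlmostComplexStructure n M) (φ : OpenPartialHomeomorph M (Model n)) (x : M)
    (i j : Fin n) : ℝ :=
  coordCovector φ i x (J x (coordVector φ j x))

/-- The Christoffel symbol `Γ^k_{i,j}`, defined by `∇_{∂x_i} ∂x_j = Γ^k_{i,j} ∂x_k`. -/
def christoffel (cov : Connection n M) (φ : OpenPartialHomeomorph M (Model n)) (x : M)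
    (i j k : Fin n) : ℝ :=
  coordCovector φ k x (cov (coordVector φ j) x (coordVector φ i x))

/-- The coordinate `p_i` on `T^* M`: `ξ = p_i dx^i`, so that `p_i(ξ) = ξ(∂x_i)`. -/
def pCoord (φ : OpenPartialHomeomorph M (Model n)) (i : Fin n) (ξ : CotangentBundle n M) : ℝ :=
  ξ.snd (coordVector φ i ξ.proj)

/-- `Γ_{i,j} = p_k Γ^k_{i,j}`, a function on `T^* M`. -/
def christoffelP (cov : Connection n M) (φ : OpenPartialHomeomorph M (Model n))
    (ξ : CotangentBundle n M) (i j : Fin n) : ℝ :=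
  ∑ k, pCoord φ k ξ * christoffel cov φ ξ.proj i j k

/-- The local coordinates `(x_1, …, x_n, p_1, …, p_n)` on `T^* M` associated with `φ`. -/
def cotCoord (φ : OpenPartialHomeomorph M (Model n)) (ξ : CotangentBundle n M) :
    Fin n ⊕ Fin n → ℝ :=
  Sum.elim (fun i => φ ξ.proj i) (fun i => pCoord φ i ξ)

/-- The components `(dx_1(Y), …, dx_n(Y), dp_1(Y), …, dp_n(Y))` of `Y ∈ T_ξ T^* M` in the basis
`∂x_1, …, ∂x_n, ∂p_1, …, ∂p_n`. -/
def components (φ : OpenPartialHomeomorph M (Model n)) (ξ : CotangentBundle n M) :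
    TT ξ →L[ℝ] (Fin n ⊕ Fin n → ℝ) :=
  mvfderiv (cotModel n) (cotCoord φ) ξ

/-- The block matrix with blocks `J^i_j` and `0` in the first row, and
`Γ_{l,i} J^l_j - Γ_{j,l} J^l_i` and `J^j_i` in the second; `i` is the row and `j` the column of an
entry. -/
def localMatrix (J : AlmostComplexStructure n M) (cov : Connection n M)
    (φ : OpenPartialHomeomorph M (Model n)) (ξ : CotangentBundle n M) :
    Matrix (Fin n ⊕ Fin n) (Fin n ⊕ Fin n) ℝ :=
  Matrix.fromBlocks
    (Matrix.of fun i j => JCoeff J φ ξ.proj i j)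
    0
    (Matrix.of fun i j => ∑ l, (christoffelP cov φ ξ l i * JCoeff J φ ξ.proj l j
      - christoffelP cov φ ξ j l * JCoeff J φ ξ.proj l i))
    (Matrix.of fun i j => JCoeff J φ ξ.proj j i)

end Basic

end CotangentLift

end

noncomputable section

namespace CotangentLift

/-! ### Sections and differentiability -/

/-! A tangent vector `Y` at `ξ` of `T^*M` is determined by `dπ Y` and by the derivatives along `Y`
of the functions `pairing W`, `ξ ↦ ξ(W)`. These derivatives are explicit: `α(W)` for the vertical
vector of `α` (`mvfderiv_pairing_vertical`), and `ξ(∇_X W)` for a horizontal vector over `X`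
(`mvfderiv_pairing_horizontal`). Horizontal lifts exist, and the kernel of `dπ` is the vertical
space by a dimension count, so every `Y` is some `h + α`.

For the matrix, take `W = ∂x_i`, so that `pairing W` is the coordinate `p_i`. On `h + α`, with `h`
over `X`, `dp_i` is `Γ_{l,i} X^l + α(∂x_i)`. Comparing this with the same formula for `h' + α ∘ J`
gives the matrix (`components_lift`), and with it existence and uniqueness of `J^{G,∇}`, since the
components are bijective.

For the complete lift, extend vectors at `ξ` to constant fields of the preferred chart. A form `ξ(L
dπ ·)` then satisfies `dθ_L(Y, Z) = Y.ξ(L Z) - Z.ξ(L Y)` (`d_thetaOf`), which covers `θ(J)` and `θ`.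
On `h + α` and `k + β`, the identity defining `J^c` for `J^{G,∇} - γ(S)` reduces to a four-term
formula for `S` (`tensorS_apply`). This proves that `J^c` exists; nondegeneracy of `ω_st` makes it
unique, and the decomposition follows. -/

/-- Every vector of a smooth vector bundle is the value of a global smooth section. -/
lemma exists_contMDiff_section {E H M F : Type*} [NormedAddCommGroup E] [NormedSpace ℝ E]
    [FiniteDimensional ℝ E] [TopologicalSpace H] {I : ModelWithCorners ℝ E H}
    [TopologicalSpace M] [T2Space M] [ChartedSpace H M] [IsManifold I ∞ M]
    [NormedAddCommGroup F] [NormedSpace ℝ F] {V : M → Type*} [TopologicalSpace (TotalSpace F V)]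
    [∀ x, AddCommGroup (V x)] [∀ x, Module ℝ (V x)] [∀ x, TopologicalSpace (V x)]
    [FiberBundle F V] [VectorBundle ℝ F V] [ContMDiffVectorBundle ∞ F V I] {x : M} (v : V x) :
    ∃ s : Π y, V y, ContMDiff I (I.prod 𝓘(ℝ, F)) ∞ (fun y => TotalSpace.mk' F y (s y)) ∧
      s x = v := by
  obtain ⟨u, hu, hs⟩ := FiberBundle.exists_contMDiffOn_extend (k := ∞) I F v
  obtain ⟨f, hf⟩ := (SmoothBumpFunction.nhds_basis_tsupport (I := I) x).mem_iff.1
    (interior_mem_nhds.2 hu)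
  -- The local extension is cut off by a bump function supported where it is smooth and equal to 1
  -- at `x`.
  refine ⟨(f : M → ℝ) • FiberBundle.extend F v,
    ContMDiffOn.smul_section_of_tsupport f.contMDiff.contMDiffOn isOpen_interior hf.2
      (hs.mono interior_subset), ?_⟩
  simp

lemma mdifferentiableAt_of_totalSpace_trivial {n : ℕ} {M : Type*} [TopologicalSpace M]
    [ChartedSpace (Model n) M] {E H N : Type*} [NormedAddCommGroup E]
    [NormedSpace ℝ E] [TopologicalSpace H] {I : ModelWithCorners ℝ E H} [TopologicalSpace N]
    [ChartedSpace H N] {b : N → M} {f : N → ℝ} {z : N}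
    (h : MDifferentiableAt I ((𝓡 n).prod 𝓘(ℝ))
      (fun m => (⟨b m, f m⟩ : TotalSpace ℝ (Bundle.Trivial M ℝ))) z) :
    MDifferentiableAt I 𝓘(ℝ) f z :=
  ((mdifferentiableAt_totalSpace _ _).1 h).2

section Differentiability

variable {n : ℕ} {M : Type*} [TopologicalSpace M] [ChartedSpace (Model n) M]
  [IsManifold (𝓡 n) ∞ M]

/-- A nonzero tangent vector is detected by a global smooth function vanishing at its base
point. -/
lemma exists_contMDiff_mvfderiv_eq_one [T2Space M] {x : M} {X : TangentSpace (𝓡 n) x}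
    (hX : X ≠ 0) :
    ∃ g : M → ℝ, ContMDiff (𝓡 n) 𝓘(ℝ) ∞ g ∧ g x = 0 ∧ mvfderiv (𝓡 n) g x X = 1 := by
  obtain ⟨ℓ, hℓ⟩ : ∃ ℓ : Model n →L[ℝ] ℝ, ℓ X = 1 :=
    SeparatingDual.exists_eq_one (R := ℝ) (V := Model n) hX
  obtain ⟨f⟩ : Nonempty (SmoothBumpFunction (𝓡 n) x) := inferInstance
  set φ := extChartAt (𝓡 n) x
  have hφ : ContMDiffOn (𝓡 n) 𝓘(ℝ) ∞ (fun y => ℓ (φ y) - ℓ (φ x))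
      (chartAt (Model n) x).source := by
    intro y hy
    exact ((ℓ.contMDiff.contMDiffAt.comp y
      (contMDiffAt_extChartAt' hy)).sub contMDiffAt_const).contMDiffWithinAt
  -- The bump function is 1 near `x`, and the preferred chart at `x` has the identity as
  -- differential there, so the derivative along `X` is `ℓ X`.
  refine ⟨fun y => f y • (ℓ (φ y) - ℓ (φ x)), f.contMDiff_smul hφ, by simp, ?_⟩
  have h1 : (fun y => f y • (ℓ (φ y) - ℓ (φ x))) =ᶠ[𝓝 x] fun y => ℓ (φ y) - ℓ (φ x) := by
    filter_upwards [f.eventuallyEq_one] with y hy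
    simp [hy]
  have h2 : mfderiv (𝓡 n) 𝓘(ℝ) (fun y => ℓ (φ y) - ℓ (φ x)) x X = ℓ X := by
    have hd : HasMFDerivAt (𝓡 n) 𝓘(ℝ, Model n) φ x (ContinuousLinearMap.id ℝ _) := by
      have := (mdifferentiableAt_extChartAt (I := 𝓡 n) (mem_chart_source (Model n) x)).hasMFDerivAt
      rwa [mfderiv_extChartAt_self] at this
    have hd' : HasMFDerivAt 𝓘(ℝ, Model n) 𝓘(ℝ) (fun z => ℓ z - ℓ (φ x)) (φ x) ℓ :=
      (ℓ.hasFDerivAt.sub_const _).hasMFDerivAt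
    rw [show (fun y => ℓ (φ y) - ℓ (φ x)) = (fun z => ℓ z - ℓ (φ x)) ∘ φ from rfl,
      (hd'.comp x hd).mfderiv]
    rfl
  rw [mvfderiv, h1.mfderiv_eq]
  exact h2.trans hℓ

/-- The differentiability at `x` of a vector field on `M`. -/
abbrev DiffVectorFieldAt (W : Π x : M, TangentSpace (𝓡 n) x) (x : M) : Prop :=
  MDifferentiableAt (𝓡 n) ((𝓡 n).prod 𝓘(ℝ, Model n))
    (fun y => (⟨y, W y⟩ : TotalSpace (Model n) (fun x : M => TangentSpace (𝓡 n) x))) x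

/-- The function `ξ ↦ ξ(W)` on `T^* M` defined by a vector field `W`. -/
def pairing (W : Π x : M, TangentSpace (𝓡 n) x) (ξ : CotangentBundle n M) : ℝ :=
  ξ.snd (W ξ.proj)

lemma mdifferentiable_proj : MDifferentiable (cotModel n) (𝓡 n)
    (fun η : CotangentBundle n M => η.proj) :=
  Bundle.mdifferentiable_proj _

lemma mdifferentiableAt_pairing {W : Π x : M, TangentSpace (𝓡 n) x} {ξ : CotangentBundle n M}
    (hW : DiffVectorFieldAt W ξ.proj) :
    MDifferentiableAt (cotModel n) 𝓘(ℝ) (pairing W) ξ := by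
  have h1 : MDifferentiableAt (cotModel n) ((𝓡 n).prod 𝓘(ℝ, Model n))
      (fun η : CotangentBundle n M => (⟨η.proj, W η.proj⟩ :
        TotalSpace (Model n) (fun x : M => TangentSpace (𝓡 n) x))) ξ :=
    MDifferentiableAt.comp ξ hW (mdifferentiable_proj ξ)
  have h2 : MDifferentiableAt (cotModel n) (cotModel n)
      (fun η : CotangentBundle n M => (⟨η.proj, η.snd⟩ : CotangentBundle n M)) ξ :=
    mdifferentiableAt_id
  exact mdifferentiableAt_of_totalSpace_trivial (MDifferentiableAt.clm_bundle_apply h2 h1)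

lemma mdifferentiableAt_apply {s : Π x : M, CotangentSpace (n := n) x}
    {W : Π x : M, TangentSpace (𝓡 n) x} {x : M}
    (hs : MDifferentiableAt (𝓡 n) (cotModel n) (fun y => (⟨y, s y⟩ : CotangentBundle n M)) x)
    (hW : DiffVectorFieldAt W x) :
    MDifferentiableAt (𝓡 n) 𝓘(ℝ) (fun y => (s y (W y) : ℝ)) x :=
  mdifferentiableAt_of_totalSpace_trivial (MDifferentiableAt.clm_bundle_apply hs hW)

lemma mdifferentiable_fibre (x : M) : MDifferentiable 𝓘(ℝ, Model n →L[ℝ] ℝ) (cotModel n)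
    (fun α : Model n →L[ℝ] ℝ => (⟨x, α⟩ : CotangentBundle n M)) := by
  intro α
  rw [mdifferentiableAt_totalSpace]
  refine ⟨mdifferentiableAt_const, ?_⟩
  set e := trivializationAt (Model n →L[ℝ] ℝ) (fun x : M => CotangentSpace (n := n) x) x
  let L : (Model n →L[ℝ] ℝ) →L[ℝ] (Model n →L[ℝ] ℝ) := e.continuousLinearMapAt ℝ x
  refine (L.mdifferentiableAt (x := α)).congr_of_eventuallyEq (Filter.Eventually.of_forall fun β => ?_)
  have hx : x ∈ e.baseSet := FiberBundle.mem_baseSet_trivializationAt' x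
  change _ = e.continuousLinearMapAt ℝ x β
  rw [Bundle.Trivialization.continuousLinearMapAt_apply]
  rw [Bundle.Trivialization.coe_linearMapAt_of_mem e hx]

end Differentiability

/-! ### Horizontal and vertical vectors -/

section Horizontal

variable {n : ℕ} {M : Type*} [TopologicalSpace M] [ChartedSpace (Model n) M]
  [IsManifold (𝓡 n) ∞ M]

lemma dproj_section {s : Π x : M, CotangentSpace (n := n) x} {x : M}
    (hs : MDifferentiableAt (𝓡 n) (cotModel n) (fun y => (⟨y, s y⟩ : CotangentBundle n M)) x)
    (X : TangentSpace (𝓡 n) x) :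
    dproj (⟨x, s x⟩ : CotangentBundle n M)
      (mfderiv (𝓡 n) (cotModel n) (fun y => (⟨y, s y⟩ : CotangentBundle n M)) x X) = X := by
  have h := (HasMFDerivAt.comp x (mdifferentiable_proj (n := n) (M := M) ⟨x, s x⟩).hasMFDerivAt
    hs.hasMFDerivAt).mfderiv
  have h2 : mfderiv (𝓡 n) (𝓡 n)
      ((fun η : CotangentBundle n M => η.proj) ∘ fun y => (⟨y, s y⟩ : CotangentBundle n M)) x =
      ContinuousLinearMap.id ℝ _ := mfderiv_id
  rw [h2] at h
  exact congr($h.symm X)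

lemma mvfderiv_pairing_section {s : Π x : M, CotangentSpace (n := n) x}
    {W : Π x : M, TangentSpace (𝓡 n) x} {x : M}
    (hs : MDifferentiableAt (𝓡 n) (cotModel n) (fun y => (⟨y, s y⟩ : CotangentBundle n M)) x)
    (hW : DiffVectorFieldAt W x) (X : TangentSpace (𝓡 n) x) :
    mvfderiv (cotModel n) (pairing W) (⟨x, s x⟩ : CotangentBundle n M)
      (mfderiv (𝓡 n) (cotModel n) (fun y => (⟨y, s y⟩ : CotangentBundle n M)) x X) =
      mvfderiv (𝓡 n) (fun y => (s y (W y) : ℝ)) x X := by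
  have h := (HasMFDerivAt.comp x
    (mdifferentiableAt_pairing (ξ := (⟨x, s x⟩ : CotangentBundle n M)) hW).hasMFDerivAt
    hs.hasMFDerivAt).mfderiv
  exact congr($h.symm X)

lemma dproj_vertical (ξ : CotangentBundle n M) (α : CotangentSpace (n := n) ξ.proj) :
    dproj ξ (vertical ξ α) = 0 := by
  have h := (HasMFDerivAt.comp (M := Model n →L[ℝ] ℝ) ξ.snd (mdifferentiable_proj (n := n) (M := M) ξ).hasMFDerivAt
    (mdifferentiable_fibre (n := n) ξ.proj ξ.snd).hasMFDerivAt).mfderiv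
  have h2 : mfderiv 𝓘(ℝ, Model n →L[ℝ] ℝ) (𝓡 n)
      ((fun η : CotangentBundle n M => η.proj) ∘
        fun α : Model n →L[ℝ] ℝ => (⟨ξ.proj, α⟩ : CotangentBundle n M)) ξ.snd = 0 :=
    mfderiv_const
  rw [h2] at h
  exact congr($h.symm α)

/-- On the fibre through `ξ` the function `pairing W` is the linear map "evaluate at `W`", which is
its own derivative. -/
lemma mvfderiv_pairing_vertical {ξ : CotangentBundle n M} {W : Π x : M, TangentSpace (𝓡 n) x}
    (hW : DiffVectorFieldAt W ξ.proj) (α : CotangentSpace (n := n) ξ.proj) :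
    mvfderiv (cotModel n) (pairing W) ξ (vertical ξ α) = α (W ξ.proj) := by
  let w : Model n := W ξ.proj
  have h := (HasMFDerivAt.comp (M := Model n →L[ℝ] ℝ) ξ.snd (mdifferentiableAt_pairing hW).hasMFDerivAt
    (mdifferentiable_fibre (n := n) ξ.proj ξ.snd).hasMFDerivAt).mfderiv
  have h2 : mfderiv 𝓘(ℝ, Model n →L[ℝ] ℝ) 𝓘(ℝ)
      (pairing W ∘ fun α : Model n →L[ℝ] ℝ => (⟨ξ.proj, α⟩ : CotangentBundle n M)) ξ.snd =
      (ContinuousLinearMap.apply ℝ ℝ w : (Model n →L[ℝ] ℝ) →L[ℝ] ℝ) :=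
    (ContinuousLinearMap.apply ℝ ℝ w).hasMFDerivAt.mfderiv
  rw [h2] at h
  exact congr($h.symm α)

/-- The Leibniz terms `df(X) s(Z)` of `X.s(fZ)` and of `s(∇_X (fZ))` cancel. Hence `∇_X s` is a
covector at `x`, and it can be tested on any field differentiable at `x`. -/
lemma tensorialAt_dualDeriv (cov : Connection n M) {x : M} (X : TangentSpace (𝓡 n) x)
    {s : Π y : M, CotangentSpace (n := n) y}
    (hs : MDifferentiableAt (𝓡 n) (cotModel n) (fun y => (⟨y, s y⟩ : CotangentBundle n M)) x) :
    TensorialAt (𝓡 n) (Model n) (fun Z => dualDeriv cov X s Z) x where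
  smul {f Z} hf hZ := by
    have e : (fun y => (s y ((f • Z) y) : ℝ)) = f • fun y => (s y (Z y) : ℝ) := by
      ext y; simp
    simp only [dualDeriv, e, cov.isCovariantDerivativeOnUniv.leibniz hZ hf,
      mvfderiv_smul hf (mdifferentiableAt_apply hs hZ)]
    simp
    ring
  add {Z Z'} hZ hZ' := by
    have e : (fun y => (s y ((Z + Z') y) : ℝ)) =
        (fun y => (s y (Z y) : ℝ)) + fun y => (s y (Z' y) : ℝ) := by
      ext y; simp
    simp only [dualDeriv, e, cov.isCovariantDerivativeOnUniv.add hZ hZ',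
      mvfderiv_add (mdifferentiableAt_apply hs hZ) (mdifferentiableAt_apply hs hZ')]
    simp
    ring

lemma SmoothVectorField.diffVectorFieldAt {Z : Π x : M, TangentSpace (𝓡 n) x}
    (hZ : SmoothVectorField Z) (x : M) : DiffVectorFieldAt Z x :=
  hZ.mdifferentiable (by simp) x

lemma SmoothOneForm.mdifferentiableAt {s : Π x : M, CotangentSpace (n := n) x}
    (hs : SmoothOneForm s) (x : M) :
    MDifferentiableAt (𝓡 n) (cotModel n) (fun y => (⟨y, s y⟩ : CotangentBundle n M)) x :=
  hs.mdifferentiable (by simp) x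

variable [T2Space M]

/-- The derivative of `ξ ↦ ξ(W)` along a horizontal vector over `X` is `ξ(∇_X W)`. -/
lemma mvfderiv_pairing_horizontal {cov : Connection n M} {ξ : CotangentBundle n M} {h : TT ξ}
    (hh : h ∈ horizontal cov ξ) {W : Π x : M, TangentSpace (𝓡 n) x}
    (hW : DiffVectorFieldAt W ξ.proj) :
    mvfderiv (cotModel n) (pairing W) ξ h = ξ.snd (cov W ξ.proj (dproj ξ h)) := by
  obtain ⟨x, p⟩ := ξ
  obtain ⟨X, s, hs, hsx, hZ, rfl⟩ := hh
  dsimp only at X hsx hZ hW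
  subst hsx
  obtain ⟨Z, hZs, hZx⟩ := exists_contMDiff_section (I := 𝓡 n) (F := Model n)
    (V := fun x : M => TangentSpace (𝓡 n) x) (W x)
  have hd := hs.mdifferentiableAt x
  have h0 : dualDeriv cov X s W = 0 := by
    -- Horizontality only tests smooth global fields; tensoriality replaces `W` by such a field with
    -- the same value at `x`.
    rw [← hZ Z hZs]
    exact (tensorialAt_dualDeriv cov X hd).pointwise hW
      (SmoothVectorField.diffVectorFieldAt hZs x) hZx.symm
  rw [mvfderiv_pairing_section hd hW, dproj_section hd]
  exact sub_eq_zero.1 h0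

lemma exists_smoothOneForm {x : M} (α : CotangentSpace (n := n) x) :
    ∃ s : Π y : M, CotangentSpace (n := n) y, SmoothOneForm s ∧ s x = α :=
  exists_contMDiff_section (I := 𝓡 n) (F := Model n →L[ℝ] ℝ) (V := fun x : M => CotangentSpace x) α

/-- Every tangent vector of `M` has a horizontal lift. -/
lemma exists_horizontal (cov : Connection n M) (ξ : CotangentBundle n M)
    (X : TangentSpace (𝓡 n) ξ.proj) : ∃ h ∈ horizontal cov ξ, dproj ξ h = X := by
  obtain ⟨x, p⟩ := ξ
  dsimp only at X
  suffices H : ∃ s : Π y : M, CotangentSpace (n := n) y, SmoothOneForm s ∧ s x = p ∧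
      ∀ Z : Π x : M, TangentSpace (𝓡 n) x, SmoothVectorField Z → dualDeriv cov X s Z = 0 by
    obtain ⟨s, hs, rfl, hZ⟩ := H
    exact ⟨_, ⟨X, s, hs, rfl, hZ, rfl⟩, dproj_section (hs.mdifferentiableAt x) X⟩
  obtain ⟨s, hs, hsx⟩ := exists_smoothOneForm (n := n) p
  by_cases hX : X = 0
  · exact ⟨s, hs, hsx, fun Z _ => by simp [dualDeriv, hX]⟩
  -- Correct `s` without changing its value at `x`: let `t` extend the covector `∇_X s`, and let `g`
  -- satisfy `g(x) = 0` and `dg(X) = 1`. Then `∇_X (g t) = t = ∇_X s` at `x`. Such a `g` requires `X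
  -- ≠ 0`, whence the case distinction.
  have hT := tensorialAt_dualDeriv cov X (hs.mdifferentiableAt x)
  obtain ⟨t, ht, htx⟩ := exists_smoothOneForm (n := n) (TensorialAt.mkHom _ x hT)
  obtain ⟨g, hg, hgx, hgX⟩ := exists_contMDiff_mvfderiv_eq_one hX
  refine ⟨s - g • t, ContMDiff.sub_section hs (ContMDiff.smul_section hg ht), by simp [hgx, hsx],
    fun Z hZ => ?_⟩
  have hZd := hZ.diffVectorFieldAt x
  have hsZ := mdifferentiableAt_apply (hs.mdifferentiableAt x) hZd
  have htZ := mdifferentiableAt_apply (ht.mdifferentiableAt x) hZd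
  have hgd : MDifferentiableAt (𝓡 n) 𝓘(ℝ) g x := hg.mdifferentiable (by simp) x
  have e : (fun y => ((s - g • t) y (Z y) : ℝ)) =
      (fun y => (s y (Z y) : ℝ)) - g • fun y => (t y (Z y) : ℝ) := by
    ext y; simp
  have h1 : (t x (Z x) : ℝ) = dualDeriv cov X s Z := by
    rw [htx]; exact TensorialAt.mkHom_apply hT hZd
  rw [dualDeriv, e, mvfderiv_sub hsZ (hgd.smul htZ), mvfderiv_smul hgd htZ]
  rw [dualDeriv] at h1
  simp [hgx, hgX, h1]

end Horizontal

/-! ### Decomposition of the tangent spaces and charts -/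

lemma two_le_infty : (2 : WithTop ℕ∞) ≤ ∞ :=
  WithTop.coe_le_coe.2 (le_top : (2 : ℕ∞) ≤ ⊤)

lemma mdifferentiableAt_pi {E H N ι : Type*} [Fintype ι] [NormedAddCommGroup E]
    [NormedSpace ℝ E] [TopologicalSpace H] {I : ModelWithCorners ℝ E H} [TopologicalSpace N]
    [ChartedSpace H N] {f : N → ι → ℝ} {z : N}
    (h : ∀ i, MDifferentiableAt I 𝓘(ℝ) (fun m => f m i) z) :
    MDifferentiableAt I 𝓘(ℝ, ι → ℝ) f z := by
  rw [mdifferentiableAt_iff]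
  refine ⟨continuousAt_pi.2 fun i => (h i).continuousAt, ?_⟩
  exact differentiableWithinAt_pi.2 fun i => ((mdifferentiableAt_iff _ _).1 (h i)).2

lemma isInvertible_mfderiv_of_mem_maximalAtlas {n : ℕ} {M : Type*}
    [TopologicalSpace M] [ChartedSpace (Model n) M] {φ : OpenPartialHomeomorph M (Model n)}
    (hφ : φ ∈ IsManifold.maximalAtlas (𝓡 n) ∞ M)
    {x : M} (hx : x ∈ φ.source) : (mfderiv (𝓡 n) 𝓘(ℝ, Model n) φ x).IsInvertible := by
  have hφ1 : φ ∈ IsManifold.maximalAtlas (𝓡 n) 1 M :=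
    IsManifold.maximalAtlas_subset_of_le (by simp) hφ
  have hm : φ.MDifferentiable (𝓡 n) (𝓡 n) :=
    ⟨fun y hy => (mdifferentiableAt_of_mem_maximalAtlas hφ1 hy).mdifferentiableWithinAt,
      fun y hy => (mdifferentiableAt_symm_of_mem_maximalAtlas hφ1 hy).mdifferentiableWithinAt⟩
  exact ⟨hm.mfderiv hx, rfl⟩

lemma mvfderiv_coordVector {n : ℕ} {M : Type*}
    [TopologicalSpace M] [ChartedSpace (Model n) M] {φ : OpenPartialHomeomorph M (Model n)}
    (hφ : φ ∈ IsManifold.maximalAtlas (𝓡 n) ∞ M)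
    {x : M} (hx : x ∈ φ.source) (i : Fin n) :
    mvfderiv (𝓡 n) φ x (coordVector φ i x) = EuclideanSpace.single i 1 :=
  (isInvertible_mfderiv_of_mem_maximalAtlas hφ hx).self_apply_inverse _

/-- `X = dx^i(X) ∂x_i`. -/
lemma sum_coordCovector_smul_coordVector {n : ℕ} {M : Type*}
    [TopologicalSpace M] [ChartedSpace (Model n) M] {φ : OpenPartialHomeomorph M (Model n)}
    (hφ : φ ∈ IsManifold.maximalAtlas (𝓡 n) ∞ M) {x : M} (hx : x ∈ φ.source)
    (X : TangentSpace (𝓡 n) x) :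
    ∑ i, coordCovector φ i x X • coordVector φ i x = X := by
  have hinj : Function.Injective (mvfderiv (𝓡 n) φ x) :=
    (isInvertible_mfderiv_of_mem_maximalAtlas hφ hx).injective
  apply hinj
  rw [map_sum]
  simp_rw [map_smul, mvfderiv_coordVector hφ hx]
  ext j
  simp [coordCovector, Finset.sum_apply, Pi.single_apply]

section Charts

variable {n : ℕ} {M : Type*} [TopologicalSpace M] [ChartedSpace (Model n) M]
  [IsManifold (𝓡 n) ∞ M]

instance (ξ : CotangentBundle n M) : FiniteDimensional ℝ (TT ξ) :=
  inferInstanceAs (FiniteDimensional ℝ (Model n × (Model n →L[ℝ] ℝ)))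

instance (ξ : CotangentBundle n M) : T2Space (TT ξ) :=
  inferInstanceAs (T2Space (Model n × (Model n →L[ℝ] ℝ)))

lemma finrank_model_dual : Module.finrank ℝ (Model n →L[ℝ] ℝ) = n := by
  rw [← (LinearMap.toContinuousLinearMap (𝕜 := ℝ) (E := Model n) (F' := ℝ)).finrank_eq,
    Module.finrank_linearMap]
  simp

lemma finrank_TT (ξ : CotangentBundle n M) : Module.finrank ℝ (TT ξ) = n + n := by
  change Module.finrank ℝ (Model n × (Model n →L[ℝ] ℝ)) = n + n
  rw [Module.finrank_prod, finrank_model_dual]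
  simp

lemma diffVectorFieldAt_extend {x : M} (v : TangentSpace (𝓡 n) x) :
    DiffVectorFieldAt (FiberBundle.extend (Model n) v) x :=
  FiberBundle.mdifferentiableAt_extend (V := fun x : M => TangentSpace (𝓡 n) x) (𝓡 n) (Model n) v

lemma vertical_injective (ξ : CotangentBundle n M) : Function.Injective (vertical ξ) := by
  intro α β hαβ
  ext v
  have h := mvfderiv_pairing_vertical (diffVectorFieldAt_extend v) α
  rw [hαβ, mvfderiv_pairing_vertical (diffVectorFieldAt_extend v)] at h
  simpa using h.symm

/-- The vectors of `T_ξ T^* M` which project to zero are vertical. -/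
lemma exists_eq_vertical [T2Space M] (cov : Connection n M) {ξ : CotangentBundle n M} {Y : TT ξ}
    (hY : dproj ξ Y = 0) : ∃ α, vertical ξ α = Y := by
  have hsurj : Function.Surjective (dproj ξ) := fun X =>
    let ⟨h, _, hh⟩ := exists_horizontal cov ξ X
    ⟨h, hh⟩
  have hle : (vertical ξ).range ≤ (dproj ξ).ker := by
    rintro _ ⟨α, rfl⟩
    exact dproj_vertical ξ α
  have hr : Module.finrank ℝ (vertical ξ).range = n :=
    (LinearMap.finrank_range_of_inj (vertical_injective ξ)).trans finrank_model_dual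
  have hk : Module.finrank ℝ (dproj ξ).ker = n := by
    have h1 := LinearMap.finrank_range_add_finrank_ker (dproj ξ).toLinearMap
    have h2 : Module.finrank ℝ (LinearMap.range (dproj ξ).toLinearMap) = n := by
      rw [LinearMap.range_eq_top.2 hsurj, finrank_top]
      exact finrank_euclideanSpace_fin
    rw [finrank_TT, h2] at h1
    exact Nat.add_left_cancel h1
  have := Submodule.eq_of_le_of_finrank_eq hle (hr.trans hk.symm)
  exact (this.symm ▸ LinearMap.mem_ker.2 hY : Y ∈ (vertical ξ).range)

/-- `T_ξ T^* M` is spanned by the horizontal and the vertical vectors. -/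
lemma exists_horizontal_add_vertical [T2Space M] (cov : Connection n M) (ξ : CotangentBundle n M)
    (Y : TT ξ) : ∃ h ∈ horizontal cov ξ, ∃ α, Y = h + vertical ξ α := by
  obtain ⟨h, hh, hhY⟩ := exists_horizontal cov ξ (dproj ξ Y)
  obtain ⟨α, hα⟩ := exists_eq_vertical cov (ξ := ξ) (Y := Y - h) (by rw [ContinuousLinearMap.map_sub, hhY, sub_self])
  exact ⟨h, hh, α, by rw [hα]; abel⟩

variable {φ : OpenPartialHomeomorph M (Model n)}

lemma diffVectorFieldAt_coordVector (hφ : φ ∈ IsManifold.maximalAtlas (𝓡 n) ∞ M)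
    {x : M} (hx : x ∈ φ.source) (i : Fin n) : DiffVectorFieldAt (coordVector φ i) x := by
  have h1 : MDifferentiableAt 𝓘(ℝ, Model n) (𝓘(ℝ, Model n).prod 𝓘(ℝ, Model n))
      (fun y : Model n => (⟨y, EuclideanSpace.single i (1 : ℝ)⟩ :
        TotalSpace (Model n) (fun x : Model n => TangentSpace 𝓘(ℝ, Model n) x))) (φ x) := by
    refine (mdifferentiableAt_section (E := (TangentSpace 𝓘(ℝ, Model n) : Model n → Type))
      _ _).2 ?_
    refine (mdifferentiableAt_const (c := (EuclideanSpace.single i 1 : Model n)))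
      |>.congr_of_eventuallyEq (Filter.Eventually.of_forall fun y => ?_)
    exact (Prod.ext_iff.1 (trivializationAt_model_space_apply (I := 𝓘(ℝ, Model n))
      ⟨y, (EuclideanSpace.single i 1 : Model n)⟩ (φ x))).2
  exact h1.mpullback_vectorField (n := ∞) (contMDiffAt_of_mem_maximalAtlas hφ hx)
    (isInvertible_mfderiv_of_mem_maximalAtlas hφ hx) two_le_infty

lemma mdifferentiableAt_cotCoord (hφ : φ ∈ IsManifold.maximalAtlas (𝓡 n) ∞ M)
    {ξ : CotangentBundle n M} (hξ : ξ.proj ∈ φ.source) :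
    MDifferentiableAt (cotModel n) 𝓘(ℝ, Fin n ⊕ Fin n → ℝ) (cotCoord φ) ξ := by
  refine mdifferentiableAt_pi fun k => ?_
  rcases k with i | i
  · have h1 : MDifferentiableAt (𝓡 n) 𝓘(ℝ, Model n) φ ξ.proj :=
      (contMDiffAt_of_mem_maximalAtlas hφ hξ).mdifferentiableAt (by simp)
    exact (EuclideanSpace.proj i : Model n →L[ℝ] ℝ).mdifferentiableAt.comp ξ
      (h1.comp ξ (mdifferentiable_proj ξ))
  · exact mdifferentiableAt_pairing (diffVectorFieldAt_coordVector hφ hξ i)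

lemma components_inl (hφ : φ ∈ IsManifold.maximalAtlas (𝓡 n) ∞ M)
    {ξ : CotangentBundle n M} (hξ : ξ.proj ∈ φ.source) (Y : TT ξ) (i : Fin n) :
    components φ ξ Y (Sum.inl i) = coordCovector φ i ξ.proj (dproj ξ Y) := by
  have h1 : MDifferentiableAt (𝓡 n) 𝓘(ℝ, Model n) φ ξ.proj :=
    (contMDiffAt_of_mem_maximalAtlas hφ hξ).mdifferentiableAt (by simp)
  have h2 := ((ContinuousLinearMap.proj (R := ℝ) (φ := fun _ : Fin n ⊕ Fin n => ℝ)
    (Sum.inl i)).hasMFDerivAt.comp ξ (mdifferentiableAt_cotCoord hφ hξ).hasMFDerivAt)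
  have h3 := (EuclideanSpace.proj i : Model n →L[ℝ] ℝ).hasMFDerivAt.comp ξ
    (h1.hasMFDerivAt.comp ξ (mdifferentiable_proj (n := n) (M := M) ξ).hasMFDerivAt)
  exact congr($(hasMFDerivAt_unique h2 h3) Y)

lemma components_inr (hφ : φ ∈ IsManifold.maximalAtlas (𝓡 n) ∞ M)
    {ξ : CotangentBundle n M} (hξ : ξ.proj ∈ φ.source) (Y : TT ξ) (i : Fin n) :
    components φ ξ Y (Sum.inr i) = mvfderiv (cotModel n) (pairing (coordVector φ i)) ξ Y := by
  have h2 := ((ContinuousLinearMap.proj (R := ℝ) (φ := fun _ : Fin n ⊕ Fin n => ℝ)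
    (Sum.inr i)).hasMFDerivAt.comp ξ (mdifferentiableAt_cotCoord hφ hξ).hasMFDerivAt)
  have h3 := (mdifferentiableAt_pairing (diffVectorFieldAt_coordVector hφ hξ i)).hasMFDerivAt
  exact congr($(hasMFDerivAt_unique h2 h3) Y)

/-- The `dx_i` detect `dπ Y`; if they vanish, `Y` is the vertical vector of some `α`, and the `dp_i`
read off `α(∂x_i)`. Surjectivity follows since both spaces have dimension `2n`. -/
lemma components_bijective [T2Space M] (cov : Connection n M)
    (hφ : φ ∈ IsManifold.maximalAtlas (𝓡 n) ∞ M)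
    {ξ : CotangentBundle n M} (hξ : ξ.proj ∈ φ.source) :
    Function.Bijective (components φ ξ) := by
  have hinj : Function.Injective (components φ ξ) := by
    refine (injective_iff_map_eq_zero (components φ ξ).toLinearMap).2 fun Y hY => ?_
    replace hY : components φ ξ Y = 0 := hY
    have h1 : dproj ξ Y = 0 := by
      rw [← sum_coordCovector_smul_coordVector hφ hξ (dproj ξ Y)]
      refine Finset.sum_eq_zero fun i _ => ?_
      rw [← components_inl hφ hξ, hY]
      simp
    obtain ⟨α, rfl⟩ := exists_eq_vertical cov h1
    have h2 : α = 0 := by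
      ext X
      rw [← sum_coordCovector_smul_coordVector hφ hξ X, map_sum]
      refine Finset.sum_eq_zero fun i _ => ?_
      rw [map_smul, ← mvfderiv_pairing_vertical (diffVectorFieldAt_coordVector hφ hξ i),
        ← components_inr hφ hξ, hY]
      simp
    rw [h2, ContinuousLinearMap.map_zero]
  refine ⟨hinj, ?_⟩
  refine (LinearMap.injective_iff_surjective_of_finrank_eq_finrank
    (f := (components φ ξ).toLinearMap) ?_).1 hinj
  rw [finrank_TT]
  simp

end Charts

/-! ### The matrix of the generalized horizontal lift -/

section LocalMatrix

variable {n : ℕ} {M : Type*} [TopologicalSpace M] [ChartedSpace (Model n) M]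
  [IsManifold (𝓡 n) ∞ M] {φ : OpenPartialHomeomorph M (Model n)}

lemma chartAt_mem_maximalAtlas (x : M) :
    chartAt (Model n) x ∈ IsManifold.maximalAtlas (𝓡 n) ∞ M :=
  IsManifold.chart_mem_maximalAtlas x

lemma coordCovector_apply_J (J : AlmostComplexStructure n M)
    (hφ : φ ∈ IsManifold.maximalAtlas (𝓡 n) ∞ M) {x : M} (hx : x ∈ φ.source)
    (X : TangentSpace (𝓡 n) x) (i : Fin n) :
    coordCovector φ i x (J x X) = ∑ j, JCoeff J φ x i j * coordCovector φ j x X := by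
  conv_lhs => rw [← sum_coordCovector_smul_coordVector hφ hx X]
  simp [JCoeff, mul_comm]

lemma apply_J_coordVector (J : AlmostComplexStructure n M)
    (hφ : φ ∈ IsManifold.maximalAtlas (𝓡 n) ∞ M) {x : M} (hx : x ∈ φ.source)
    (α : CotangentSpace (n := n) x) (i : Fin n) :
    (α (J x (coordVector φ i x)) : ℝ) = ∑ j, JCoeff J φ x j i * (α (coordVector φ j x) : ℝ) := by
  conv_lhs => rw [← sum_coordCovector_smul_coordVector hφ hx (J x (coordVector φ i x))]
  simp [JCoeff]

lemma apply_cov_coordVector (cov : Connection n M) (hφ : φ ∈ IsManifold.maximalAtlas (𝓡 n) ∞ M)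
    {ξ : CotangentBundle n M} (hξ : ξ.proj ∈ φ.source) (X : TangentSpace (𝓡 n) ξ.proj)
    (i : Fin n) :
    (ξ.snd (cov (coordVector φ i) ξ.proj X) : ℝ) =
      ∑ l, coordCovector φ l ξ.proj X * christoffelP cov φ ξ l i := by
  conv_lhs => rw [← sum_coordCovector_smul_coordVector hφ hξ X]
  simp only [map_sum, map_smul]
  refine Finset.sum_congr rfl fun l _ => ?_
  rw [smul_eq_mul]
  congr 1
  conv_lhs => rw [← sum_coordCovector_smul_coordVector hφ hξ
    (cov (coordVector φ i) ξ.proj (coordVector φ l ξ.proj))]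
  simp [christoffelP, christoffel, pCoord, mul_comm]

variable [T2Space M]

/-- This one computation carries the matrix formula as well as the existence and uniqueness of the
lift: it gives the components of the prescribed image in terms of those of `h + α` alone. -/
lemma components_lift (J : AlmostComplexStructure n M) (cov : Connection n M)
    (hφ : φ ∈ IsManifold.maximalAtlas (𝓡 n) ∞ M) {ξ : CotangentBundle n M}
    (hξ : ξ.proj ∈ φ.source) {h h' : TT ξ} (hh : h ∈ horizontal cov ξ)
    (hh' : h' ∈ horizontal cov ξ) (hJ : dproj ξ h' = J ξ.proj (dproj ξ h))
    (α : CotangentSpace (n := n) ξ.proj) :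
    components φ ξ (h' + vertical ξ (α.comp (J ξ.proj))) =
      (localMatrix J cov φ ξ).mulVec (components φ ξ (h + vertical ξ α)) := by
  have hW := fun i => diffVectorFieldAt_coordVector hφ hξ i
  have hl : ∀ j, components φ ξ (h + vertical ξ α) (Sum.inl j) =
      coordCovector φ j ξ.proj (dproj ξ h) := fun j => by
    rw [components_inl hφ hξ, ContinuousLinearMap.map_add, dproj_vertical, add_zero]
  have hr : ∀ j, components φ ξ (h + vertical ξ α) (Sum.inr j) =
      ∑ l, coordCovector φ l ξ.proj (dproj ξ h) * christoffelP cov φ ξ l j +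
        (α (coordVector φ j ξ.proj) : ℝ) := fun j => by
    rw [components_inr hφ hξ, ContinuousLinearMap.map_add, mvfderiv_pairing_vertical (hW j),
      mvfderiv_pairing_horizontal hh (hW j), apply_cov_coordVector cov hφ hξ]
  rw [localMatrix, Matrix.fromBlocks_mulVec]
  ext k
  rcases k with i | i
  · rw [components_inl hφ hξ, ContinuousLinearMap.map_add, dproj_vertical, add_zero, hJ,
      coordCovector_apply_J J hφ hξ]
    simp only [Sum.elim_inl, Pi.add_apply, Matrix.mulVec, dotProduct, Matrix.of_apply,
      Function.comp_apply, hl, Matrix.zero_apply, zero_mul, Finset.sum_const_zero, add_zero]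
  · rw [components_inr hφ hξ, ContinuousLinearMap.map_add, mvfderiv_pairing_vertical (hW i),
      mvfderiv_pairing_horizontal hh' (hW i), apply_cov_coordVector cov hφ hξ, hJ,
      ContinuousLinearMap.comp_apply, apply_J_coordVector J hφ hξ]
    simp only [coordCovector_apply_J J hφ hξ, Sum.elim_inr, Pi.add_apply, Matrix.mulVec,
      dotProduct, Matrix.of_apply, Function.comp_apply, hl, hr, mul_add, Finset.sum_add_distrib,
      ← add_assoc]
    congr 1
    -- Only the terms in `Γ` remain. The part `-Γ_{j,l} J^l_i` of the lower left block cancels what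
    -- `ᵗJ` makes of the `dp`-components `Γ_{l,j} X^l` of `h`.
    simp only [Finset.sum_mul, Finset.mul_sum, sub_mul, Finset.sum_sub_distrib]
    rw [Finset.sum_comm, eq_comm, sub_add_eq_add_sub, sub_eq_iff_eq_add]
    congr 1
    · exact Finset.sum_congr rfl fun _ _ => Finset.sum_congr rfl fun _ _ => by ring
    · rw [Finset.sum_comm]
      exact Finset.sum_congr rfl fun _ _ => Finset.sum_congr rfl fun _ _ => by ring

lemma IsGeneralizedHorizontalLift.components_apply {J : AlmostComplexStructure n M}
    {cov : Connection n M} {A : EndField n M} (hA : IsGeneralizedHorizontalLift J cov A)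
    (hφ : φ ∈ IsManifold.maximalAtlas (𝓡 n) ∞ M) {ξ : CotangentBundle n M}
    (hξ : ξ.proj ∈ φ.source) (Y : TT ξ) :
    components φ ξ (A ξ Y) = (localMatrix J cov φ ξ).mulVec (components φ ξ Y) := by
  obtain ⟨h, hh, α, rfl⟩ := exists_horizontal_add_vertical cov ξ Y
  obtain ⟨h', hh', hJ⟩ := exists_horizontal cov ξ (J ξ.proj (dproj ξ h))
  rw [hA ξ h hh h' hh' hJ α]
  exact components_lift J cov hφ hξ hh hh' hJ α

lemma IsGeneralizedHorizontalLift.unique {J : AlmostComplexStructure n M}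
    {cov : Connection n M} {A B : EndField n M} (hA : IsGeneralizedHorizontalLift J cov A)
    (hB : IsGeneralizedHorizontalLift J cov B) : A = B := by
  funext ξ
  ext1 Y
  have hφ := chartAt_mem_maximalAtlas (n := n) ξ.proj
  have hξ := mem_chart_source (Model n) ξ.proj
  apply (components_bijective cov hφ hξ).injective
  rw [hA.components_apply hφ hξ, hB.components_apply hφ hξ]

/-- Defining the endomorphism by its matrix in one chart at each point avoids a separate proof that
the horizontal space is linear or that the decomposition is unique: `components_lift` gives the
prescribed value for every decomposition. -/
lemma exists_isGeneralizedHorizontalLift (J : AlmostComplexStructure n M)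
    (cov : Connection n M) : ∃ A : EndField n M, IsGeneralizedHorizontalLift J cov A := by
  have hb : ∀ ξ : CotangentBundle n M,
      Function.Bijective (components (chartAt (Model n) ξ.proj) ξ).toLinearMap := fun ξ =>
    components_bijective cov (chartAt_mem_maximalAtlas ξ.proj) (mem_chart_source _ ξ.proj)
  let e : ∀ ξ : CotangentBundle n M, TT ξ ≃ₗ[ℝ] (Fin n ⊕ Fin n → ℝ) := fun ξ =>
    LinearEquiv.ofBijective _ (hb ξ)
  refine ⟨fun ξ => LinearMap.toContinuousLinearMap ((e ξ).symm.toLinearMap ∘ₗ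
    (localMatrix J cov (chartAt (Model n) ξ.proj) ξ).mulVecLin ∘ₗ (e ξ).toLinearMap), ?_⟩
  intro ξ h hh h' hh' hJ α
  refine (LinearEquiv.symm_apply_eq (e ξ)).2 ?_
  exact (components_lift J cov (chartAt_mem_maximalAtlas ξ.proj) (mem_chart_source _ ξ.proj)
    hh hh' hJ α).symm

lemma isGeneralizedHorizontalLift_generalizedHorizontalLift (J : AlmostComplexStructure n M)
    (cov : Connection n M) :
    IsGeneralizedHorizontalLift J cov (generalizedHorizontalLift J cov) :=
  Classical.epsilon_spec (exists_isGeneralizedHorizontalLift J cov)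

end LocalMatrix

/-! ### The preferred chart of the cotangent bundle -/

lemma symmL_apply_of_mem {B F : Type*} {V : B → Type*} [TopologicalSpace B]
    [NormedAddCommGroup F] [NormedSpace ℝ F] [TopologicalSpace (TotalSpace F V)]
    [∀ x, AddCommGroup (V x)] [∀ x, Module ℝ (V x)] [∀ x, TopologicalSpace (V x)]
    [FiberBundle F V] (e : Trivialization F (TotalSpace.proj : TotalSpace F V → B))
    [e.IsLinear ℝ] {b : B} (hb : b ∈ e.baseSet) (v : F) : e.symmL ℝ b v = e.symm b v :=
  e.symmₗ_apply hb v

section PreferredChart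

variable {n : ℕ} {M : Type*} [TopologicalSpace M] [ChartedSpace (Model n) M]
  [IsManifold (𝓡 n) ∞ M]

/-- The vector field which is constant, with value `v` at `x`, in the preferred chart at `x`. -/
abbrev constField {x : M} (v : TangentSpace (𝓡 n) x) : Π y : M, TangentSpace (𝓡 n) y :=
  FiberBundle.extend (Model n) v

/-- The differential of the inverse chart is the inverse of the trivialization of the tangent bundle
at `x`, and so is the extension of `v`, because over `x` itself the trivialization is the identity.
-/
lemma mfderiv_extChartAt_symm {x : M} {u : Model n} (hu : u ∈ (extChartAt (𝓡 n) x).target)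
    (v : TangentSpace (𝓡 n) x) :
    mfderiv 𝓘(ℝ, Model n) (𝓡 n) (extChartAt (𝓡 n) x).symm u v =
      constField v ((extChartAt (𝓡 n) x).symm u) := by
  set φ := extChartAt (𝓡 n) x
  have hy : φ.symm u ∈ (chartAt (Model n) x).source := by
    rw [← extChartAt_source (𝓡 n)]; exact φ.map_target hu
  have h1 := TangentBundle.symmL_trivializationAt (I := 𝓡 n) (𝕜 := ℝ) hy
  rw [φ.right_inv hu, ModelWithCorners.range_eq_univ, mfderivWithin_univ] at h1
  have h2 := TangentBundle.continuousLinearMapAt_trivializationAt (I := 𝓡 n) (𝕜 := ℝ)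
    (mem_chart_source (Model n) x)
  rw [mfderiv_extChartAt_self] at h2
  have h3 : (trivializationAt (Model n) (TangentSpace (𝓡 n)) x ⟨x, v⟩).2 = v := by
    have := congr($h2 v)
    rwa [Bundle.Trivialization.continuousLinearMapAt_apply,
      Bundle.Trivialization.coe_linearMapAt_of_mem _
        (FiberBundle.mem_baseSet_trivializationAt' x)] at this
  have h4 : φ.symm u ∈ (trivializationAt (Model n) (TangentSpace (𝓡 n)) x).baseSet := hy
  rw [← h1]
  change _ = (trivializationAt (Model n) (TangentSpace (𝓡 n)) x).symm (φ.symm u)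
    (trivializationAt (Model n) (TangentSpace (𝓡 n)) x ⟨x, v⟩).2
  rw [h3]
  exact symmL_apply_of_mem _ h4 v

lemma extChartAt_fst (ξ η : CotangentBundle n M) :
    (extChartAt (cotModel n) ξ η).1 = extChartAt (𝓡 n) ξ.proj η.proj := by
  simp only [extChartAt_coe, Function.comp_apply]
  rw [hom_chart]
  rfl

lemma hasMFDerivAt_extChartAt_self (ξ : CotangentBundle n M) :
    HasMFDerivAt (cotModel n) 𝓘(ℝ, Model n × (Model n →L[ℝ] ℝ))
      (extChartAt (cotModel n) ξ) ξ (ContinuousLinearMap.id ℝ _) := by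
  have := (mdifferentiableAt_extChartAt (I := cotModel n) (mem_chart_source _ ξ)).hasMFDerivAt
  rwa [mfderiv_extChartAt_self] at this

/-- In the preferred chart at `ξ`, the differential of `π` at `ξ` is the first projection. -/
lemma dproj_apply_eq_fst (ξ : CotangentBundle n M) (Y : TT ξ) :
    dproj ξ Y = (show Model n × (Model n →L[ℝ] ℝ) from Y).1 := by
  have h1 : HasMFDerivAt (𝓡 n) 𝓘(ℝ, Model n) (extChartAt (𝓡 n) ξ.proj) ξ.proj
      (ContinuousLinearMap.id ℝ _) := by
    have := (mdifferentiableAt_extChartAt (I := 𝓡 n)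
      (mem_chart_source (Model n) ξ.proj)).hasMFDerivAt
    rwa [mfderiv_extChartAt_self] at this
  have h2 := (ContinuousLinearMap.fst ℝ (Model n) (Model n →L[ℝ] ℝ)).hasMFDerivAt.comp ξ
    (hasMFDerivAt_extChartAt_self ξ)
  have h3 := h1.comp ξ (mdifferentiable_proj (n := n) (M := M) ξ).hasMFDerivAt
  have h4 := h3.congr_of_eventuallyEq
    (f₁ := ContinuousLinearMap.fst ℝ (Model n) (Model n →L[ℝ] ℝ) ∘ (extChartAt (cotModel n) ξ))
    (Filter.Eventually.of_forall fun η => extChartAt_fst ξ η)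
  exact congr($(hasMFDerivAt_unique h4 h2) Y)

lemma mdifferentiableAt_extChartAt_symm {ξ : CotangentBundle n M}
    {z : Model n × (Model n →L[ℝ] ℝ)} (hz : z ∈ (extChartAt (cotModel n) ξ).target) :
    MDifferentiableAt 𝓘(ℝ, Model n × (Model n →L[ℝ] ℝ)) (cotModel n)
      (extChartAt (cotModel n) ξ).symm z := by
  have := mdifferentiableWithinAt_extChartAt_symm hz
  rwa [ModelWithCorners.range_eq_univ, mdifferentiableWithinAt_univ] at this

lemma proj_extChartAt_symm {ξ : CotangentBundle n M} {z : Model n × (Model n →L[ℝ] ℝ)}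
    (hz : z ∈ (extChartAt (cotModel n) ξ).target) :
    z.1 ∈ (extChartAt (𝓡 n) ξ.proj).target ∧
      ((extChartAt (cotModel n) ξ).symm z).proj = (extChartAt (𝓡 n) ξ.proj).symm z.1 := by
  have h1 : z.1 ∈ (extChartAt (𝓡 n) ξ.proj).target := by
    rw [FiberBundle.extChartAt_target] at hz
    exact hz.1.1
  refine ⟨h1, ?_⟩
  rw [extChartAt_target] at hz
  exact FiberBundle.chartedSpace_chartAt_symm_fst ξ z hz.1

/-- In the preferred charts at `ξ` and `π ξ` the map `π` is the first projection, so constant fields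
project to constant fields. -/
lemma dproj_mfderiv_extChartAt_symm {ξ : CotangentBundle n M} {z : Model n × (Model n →L[ℝ] ℝ)}
    (hz : z ∈ (extChartAt (cotModel n) ξ).target) (V : TT ξ) :
    dproj ((extChartAt (cotModel n) ξ).symm z)
      (mfderiv 𝓘(ℝ, Model n × (Model n →L[ℝ] ℝ)) (cotModel n)
        (extChartAt (cotModel n) ξ).symm z V) =
      constField (dproj ξ V) ((extChartAt (cotModel n) ξ).symm z).proj := by
  set ψ := extChartAt (cotModel n) ξ
  obtain ⟨hz1, hz2⟩ := proj_extChartAt_symm hz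
  have h1 := (mdifferentiable_proj (n := n) (M := M) (ψ.symm z)).hasMFDerivAt.comp z
    (mdifferentiableAt_extChartAt_symm hz).hasMFDerivAt
  have h2 : MDifferentiableAt 𝓘(ℝ, Model n) (𝓡 n) (extChartAt (𝓡 n) ξ.proj).symm z.1 := by
    have := mdifferentiableWithinAt_extChartAt_symm hz1
    rwa [ModelWithCorners.range_eq_univ, mdifferentiableWithinAt_univ] at this
  have h3 := (h2.hasMFDerivAt.comp z
    (ContinuousLinearMap.fst ℝ (Model n) (Model n →L[ℝ] ℝ)).hasMFDerivAt)
  have h4 := h1.congr_of_eventuallyEq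
    (f₁ := (extChartAt (𝓡 n) ξ.proj).symm ∘
      ContinuousLinearMap.fst ℝ (Model n) (Model n →L[ℝ] ℝ)) (by
    filter_upwards [(isOpen_extChartAt_target (I := cotModel n) ξ).mem_nhds hz] with w hw
    exact (proj_extChartAt_symm hw).2.symm)
  have h5 := congr($(hasMFDerivAt_unique h4 h3) V)
  refine h5.trans ?_
  rw [hz2, ← mfderiv_extChartAt_symm hz1, dproj_apply_eq_fst]
  rfl

end PreferredChart

/-! ### Exterior derivatives of semibasic forms -/

section ExteriorDerivative

variable {n : ℕ} {M : Type*} [TopologicalSpace M] [ChartedSpace (Model n) M]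
  [IsManifold (𝓡 n) ∞ M]

/-- The one-form `Y ↦ ξ(L dπ Y)` on `T^* M` defined by a field `L` of endomorphisms. -/
def thetaOf (L : Π x : M, TangentSpace (𝓡 n) x →L[ℝ] TangentSpace (𝓡 n) x) : OneForm n M :=
  fun ξ => (ContinuousLinearMap.comp ξ.snd (L ξ.proj)).comp (dproj ξ)

lemma inChart_thetaOf (L : Π x : M, TangentSpace (𝓡 n) x →L[ℝ] TangentSpace (𝓡 n) x)
    {ξ : CotangentBundle n M} {z : Model n × (Model n →L[ℝ] ℝ)}
    (hz : z ∈ (extChartAt (cotModel n) ξ).target) (V : TT ξ) :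
    (thetaOf L).inChart ξ z V =
      pairing (fun y => L y (constField (dproj ξ V) y)) ((extChartAt (cotModel n) ξ).symm z) := by
  have h := dproj_mfderiv_extChartAt_symm hz V
  exact congrArg (fun w => (((extChartAt (cotModel n) ξ).symm z).snd (L _ w) : ℝ)) h

lemma hasFDerivAt_pairing_extChartAt_symm {ξ : CotangentBundle n M}
    {W : Π x : M, TangentSpace (𝓡 n) x} (hW : DiffVectorFieldAt W ξ.proj) :
    HasFDerivAt (fun z => pairing W ((extChartAt (cotModel n) ξ).symm z))
      (mvfderiv (cotModel n) (pairing W) ξ : Model n × (Model n →L[ℝ] ℝ) →L[ℝ] ℝ)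
      (extChartAt (cotModel n) ξ ξ) := by
  have h : HasFDerivWithinAt (fun z => pairing W ((extChartAt (cotModel n) ξ).symm z))
      (mvfderiv (cotModel n) (pairing W) ξ : Model n × (Model n →L[ℝ] ℝ) →L[ℝ] ℝ)
      (range (cotModel n)) (extChartAt (cotModel n) ξ ξ) :=
    (mdifferentiableAt_pairing hW).hasMFDerivAt.2
  exact h.hasFDerivAt (by rw [ModelWithCorners.range_eq_univ]; exact Filter.univ_mem)

/-- `OneForm.d` differentiates a functional-valued map, while the `pairing` formulas control its
values on fixed vectors; expanding in a finite basis bridges the two. -/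
lemma differentiableAt_clm_model {G : Type*} [NormedAddCommGroup G] [NormedSpace ℝ G]
    {F : Type*} [NormedAddCommGroup F] [NormedSpace ℝ F] [FiniteDimensional ℝ F]
    {f : G → F →L[ℝ] ℝ} {z : G} (h : ∀ v, DifferentiableAt ℝ (fun w => f w v) z) :
    DifferentiableAt ℝ f z := by
  let b := Module.finBasis ℝ F
  have e : f = fun w => ∑ i, f w (b i) • (LinearMap.toContinuousLinearMap (b.coord i)) := by
    ext w v
    conv_lhs => rw [← b.sum_repr v]
    simp only [map_sum, map_smul, smul_eq_mul, sum_apply,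
      smul_apply, LinearMap.coe_toContinuousLinearMap',
      Module.Basis.coord_apply, mul_comm]
  rw [e]
  exact DifferentiableAt.fun_sum fun i _ => (h (b i)).smul_const _

lemma fderiv_apply_of_hasFDerivAt_apply {G F : Type*} [NormedAddCommGroup G] [NormedSpace ℝ G]
    [NormedAddCommGroup F] [NormedSpace ℝ F] {f : G → F →L[ℝ] ℝ} {f' : G →L[ℝ] ℝ} {z : G} {v : F}
    (hf : DifferentiableAt ℝ f z) (h : HasFDerivAt (fun w => f w v) f' z) (w : G) :
    fderiv ℝ f z w v = f' w := by
  rw [← (hf.hasFDerivAt.clm_apply (hasFDerivAt_const v z)).unique h]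
  simp

lemma lieBracketWithin_eq_zero_of_eventuallyEq_const {G : Type*} [NormedAddCommGroup G]
    [NormedSpace ℝ G] {V W : G → G} {v w : G} {s : Set G} {z : G} (hV : V =ᶠ[𝓝 z] fun _ => v)
    (hW : W =ᶠ[𝓝 z] fun _ => w) : VectorField.lieBracketWithin ℝ V W s z = 0 := by
  have h : ∀ {U : G → G} {u : G}, U =ᶠ[𝓝 z] (fun _ => u) → fderivWithin ℝ U s z = 0 :=
    fun hU => (hU.fderivWithin_eq_of_nhds).trans (by simp)
  simp [VectorField.lieBracketWithin_eq, h hV, h hW]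

/-- `(dθ_L)(Y, Z)` in terms of the derivatives of the functions `ξ(L Z)` and `ξ(L Y)`, where `Y`
and `Z` are extended by constant vector fields. -/
lemma d_thetaOf (L : Π x : M, TangentSpace (𝓡 n) x →L[ℝ] TangentSpace (𝓡 n) x)
    {ξ : CotangentBundle n M}
    (hL : ∀ v : TangentSpace (𝓡 n) ξ.proj, DiffVectorFieldAt (fun y => L y (constField v y)) ξ.proj)
    (Y Z : TT ξ) :
    (thetaOf L).d ξ Y Z =
      mvfderiv (cotModel n) (pairing fun y => L y (constField (dproj ξ Z) y)) ξ Y -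
      mvfderiv (cotModel n) (pairing fun y => L y (constField (dproj ξ Y) y)) ξ Z := by
  have hd : ∀ V : TT ξ, HasFDerivAt (fun z => (thetaOf L).inChart ξ z V)
      (mvfderiv (cotModel n) (pairing fun y => L y (constField (dproj ξ V) y)) ξ :
        Model n × (Model n →L[ℝ] ℝ) →L[ℝ] ℝ) (extChartAt (cotModel n) ξ ξ) := fun V =>
    (hasFDerivAt_pairing_extChartAt_symm (hL (dproj ξ V))).congr_of_eventuallyEq (by
      filter_upwards [(isOpen_extChartAt_target (I := cotModel n) ξ).mem_nhds
        (mem_extChartAt_target ξ)] with z hz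
      exact inChart_thetaOf L hz V)
  have hF : DifferentiableAt ℝ ((thetaOf L).inChart ξ) (extChartAt (cotModel n) ξ ξ) :=
    differentiableAt_clm_model fun V => (hd V).differentiableAt
  have he : ∀ V W : TT ξ, fderiv ℝ ((thetaOf L).inChart ξ) (extChartAt (cotModel n) ξ ξ) W V =
      mvfderiv (cotModel n) (pairing fun y => L y (constField (dproj ξ V) y)) ξ W := fun V W =>
    fderiv_apply_of_hasFDerivAt_apply hF (hd V) W
  have hψ : ∀ V : TT ξ, mvfderiv (cotModel n) (extChartAt (cotModel n) ξ) ξ V = V := fun V =>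
    congr($((hasMFDerivAt_extChartAt_self ξ).mfderiv) V)
  rw [← he, ← he]
  simp only [OneForm.d]
  rw [hψ, hψ]

lemma thetaJ_d (J : AlmostComplexStructure n M) (ξ : CotangentBundle n M) (Y Z : TT ξ) :
    (thetaJ J).d ξ Y Z =
      mvfderiv (cotModel n) (pairing fun y => J y (constField (dproj ξ Z) y)) ξ Y -
      mvfderiv (cotModel n) (pairing fun y => J y (constField (dproj ξ Y) y)) ξ Z :=
  d_thetaOf J (fun v => J.mdifferentiableAt_apply (diffVectorFieldAt_extend v)) Y Z

lemma omegaSt_apply (ξ : CotangentBundle n M) (Y Z : TT ξ) :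
    omegaSt ξ Y Z =
      mvfderiv (cotModel n) (pairing (constField (dproj ξ Z))) ξ Y -
      mvfderiv (cotModel n) (pairing (constField (dproj ξ Y))) ξ Z :=
  d_thetaOf (fun _ => ContinuousLinearMap.id ℝ _) (fun v => diffVectorFieldAt_extend v) Y Z

/-- Both fields are constant near the centre of the preferred chart at `x`. Hence torsion on
constant extensions is just a difference of covariant derivatives. -/
lemma mlieBracket_constField {x : M} (v w : TangentSpace (𝓡 n) x) :
    VectorField.mlieBracket (𝓡 n) (constField v) (constField w) x = 0 := by
  have h : ∀ v : TangentSpace (𝓡 n) x,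
      VectorField.mpullbackWithin 𝓘(ℝ, Model n) (𝓡 n) (extChartAt (𝓡 n) x).symm
        (constField v) (range (𝓡 n)) =ᶠ[𝓝 (extChartAt (𝓡 n) x x)] fun _ => (v : Model n) := by
    intro v
    filter_upwards [(isOpen_extChartAt_target (I := 𝓡 n) x).mem_nhds
      (mem_extChartAt_target x)] with u hu
    have hi := isInvertible_mfderivWithin_extChartAt_symm hu
    refine hi.inverse_apply_eq.2 ?_
    rw [ModelWithCorners.range_eq_univ, mfderivWithin_univ]
    exact (mfderiv_extChartAt_symm hu v).symm
  rw [← VectorField.mlieBracketWithin_univ, VectorField.mlieBracketWithin_apply]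
  exact (congrArg _ (lieBracketWithin_eq_zero_of_eventuallyEq_const (h v) (h w))).trans
    (ContinuousLinearMap.map_zero _)

end ExteriorDerivative

/-! ### The complete lift -/

section CompleteLift

variable {n : ℕ} {M : Type*} [TopologicalSpace M] [ChartedSpace (Model n) M]
  [IsManifold (𝓡 n) ∞ M]

lemma torsion_apply_constField (cov : Connection n M) {x : M} (v w : TangentSpace (𝓡 n) x) :
    cov.torsion x v w = cov (constField w) x v - cov (constField v) x w := by
  have h := cov.torsion_apply (diffVectorFieldAt_extend v) (diffVectorFieldAt_extend w)
  rw [mlieBracket_constField] at h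
  simpa using h

/-- The terms `J ∇` coming from `∇J` cancel those of `-J T`. The fields `J (constField v)` and
`constField (J x v)` agree at `x` only, so their covariant derivatives remain as separate terms. -/
lemma tensorS_apply (J : AlmostComplexStructure n M) (cov : Connection n M) {x : M}
    (v w : TangentSpace (𝓡 n) x) :
    tensorS J cov x v w = cov (constField w) x (J x v) -
      cov (fun y => J y (constField w y)) x v + cov (fun y => J y (constField v y)) x w -
      cov (constField (J x v)) x w := by
  -- `TensorialAt.mkHom₂` evaluates on the extensions `FiberBundle.extend`, which are the constant
  -- fields.
  have h : tensorS J cov x v w = SField J cov (constField v) (constField w) x := rfl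
  rw [h]
  simp only [SField, nablaJ, constField, FiberBundle.extend_apply_self]
  rw [torsion_apply_constField, torsion_apply_constField]
  simp only [map_sub]
  abel

/-- The symplectic form `ω_st` is nondegenerate. -/
lemma eq_of_omegaSt_eq {ξ : CotangentBundle n M} {Y Y' : TT ξ}
    (h : ∀ Z, omegaSt ξ Y Z = omegaSt ξ Y' Z) : dproj ξ Y = dproj ξ Y' ∧
      ∀ Z : TT ξ, mvfderiv (cotModel n) (pairing (constField (dproj ξ Z))) ξ Y =
        mvfderiv (cotModel n) (pairing (constField (dproj ξ Z))) ξ Y' := by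
  have h1 : dproj ξ Y = dproj ξ Y' := by
    have h2 : ∀ (α : CotangentSpace (n := n) ξ.proj) (Y : TT ξ), omegaSt ξ Y (vertical ξ α) =
        mvfderiv (cotModel n) (pairing (constField (0 : TangentSpace (𝓡 n) ξ.proj))) ξ Y -
          (α (dproj ξ Y) : ℝ) := fun α Y => by
      rw [omegaSt_apply, mvfderiv_pairing_vertical (diffVectorFieldAt_extend _), dproj_vertical,
        FiberBundle.extend_apply_self]
    have h3 : ∀ α : CotangentSpace (n := n) ξ.proj, (α (dproj ξ Y) : ℝ) = α (dproj ξ Y') := by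
      intro α
      -- The case `α = 0` isolates the derivative of the pairing with the extension of 0, which then
      -- drops out of the identity for `α`.
      have h4 := h (vertical ξ 0)
      have h5 := h (vertical ξ α)
      rw [h2, h2] at h4 h5
      rw [_root_.zero_apply, _root_.zero_apply, sub_zero, sub_zero] at h4
      rw [h4] at h5
      exact sub_right_injective h5
    exact (SeparatingDual.eq_iff_forall_dual_eq (R := ℝ) (V := Model n)).2 h3
  refine ⟨h1, fun Z => ?_⟩
  have h2 := h Z
  rw [omegaSt_apply, omegaSt_apply, h1] at h2
  exact sub_left_injective h2

lemma gammaContraction_apply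
    (R : Π x : M, TangentSpace (𝓡 n) x →L[ℝ] TangentSpace (𝓡 n) x →L[ℝ] TangentSpace (𝓡 n) x)
    (ξ : CotangentBundle n M) (Y : TT ξ) :
    gammaContraction R ξ Y = vertical ξ (ContinuousLinearMap.comp ξ.snd (R ξ.proj (dproj ξ Y))) :=
  rfl

variable [T2Space M]

lemma mvfderiv_pairing_add_vertical {cov : Connection n M} {ξ : CotangentBundle n M} {h : TT ξ}
    (hh : h ∈ horizontal cov ξ) (α : CotangentSpace (n := n) ξ.proj)
    {W : Π x : M, TangentSpace (𝓡 n) x} (hW : DiffVectorFieldAt W ξ.proj) :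
    mvfderiv (cotModel n) (pairing W) ξ (h + vertical ξ α) =
      (ξ.snd (cov W ξ.proj (dproj ξ h)) : ℝ) + (α (W ξ.proj) : ℝ) := by
  rw [ContinuousLinearMap.map_add, mvfderiv_pairing_horizontal hh hW, mvfderiv_pairing_vertical hW]

/-- By nondegeneracy `A Y` and `B Y` have the same projection and the same pairing derivatives, so
their difference is vertical with zero covector. The connection is auxiliary: it provides horizontal
lifts, hence surjectivity of `dπ`. -/
lemma IsCompleteLift.unique (cov : Connection n M) {J : AlmostComplexStructure n M}
    {A B : EndField n M} (hA : IsCompleteLift J A) (hB : IsCompleteLift J B) : A = B := by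
  funext ξ
  ext1 Y
  obtain ⟨h1, h2⟩ := eq_of_omegaSt_eq (ξ := ξ) (Y := A ξ Y) (Y' := B ξ Y)
    fun Z => (hA ξ Y Z).symm.trans (hB ξ Y Z)
  obtain ⟨α, hα⟩ := exists_eq_vertical cov (ξ := ξ) (Y := A ξ Y - B ξ Y)
    (by rw [ContinuousLinearMap.map_sub, h1, sub_self])
  have h3 : α = 0 := by
    ext v
    obtain ⟨Z, -, rfl⟩ := exists_horizontal cov ξ v
    have h4 := mvfderiv_pairing_vertical (diffVectorFieldAt_extend (dproj ξ Z)) α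
    rw [hα, ContinuousLinearMap.map_sub, h2 Z, sub_self, FiberBundle.extend_apply_self] at h4
    exact h4.symm
  rw [h3, ContinuousLinearMap.map_zero] at hα
  exact sub_eq_zero.1 hα.symm

/-- `J^{G,∇} - γ(S)` satisfies the identity which defines the complete lift. -/
lemma IsGeneralizedHorizontalLift.isCompleteLift_sub {J : AlmostComplexStructure n M}
    {cov : Connection n M} {A : EndField n M} (hA : IsGeneralizedHorizontalLift J cov A) :
    IsCompleteLift J (A - gammaContraction (tensorS J cov)) := by
  intro ξ Y Z
  obtain ⟨h, hh, α, rfl⟩ := exists_horizontal_add_vertical cov ξ Y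
  obtain ⟨k, hk, β, rfl⟩ := exists_horizontal_add_vertical cov ξ Z
  obtain ⟨h', hh', hJ⟩ := exists_horizontal cov ξ (J ξ.proj (dproj ξ h))
  have hp : ∀ (h : TT ξ) α, dproj ξ (h + vertical ξ α) = dproj ξ h := fun h α => by
    rw [ContinuousLinearMap.map_add, dproj_vertical, add_zero]
  have hJd : ∀ v : TangentSpace (𝓡 n) ξ.proj,
      DiffVectorFieldAt (fun y => J y (constField v y)) ξ.proj := fun v =>
    J.mdifferentiableAt_apply (diffVectorFieldAt_extend v)
  have hY : (A - gammaContraction (tensorS J cov)) ξ (h + vertical ξ α) =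
      h' + vertical ξ (α.comp (J ξ.proj) -
        ContinuousLinearMap.comp ξ.snd (tensorS J cov ξ.proj (dproj ξ h))) := by
    rw [ContinuousLinearMap.map_sub, ← add_sub_assoc, ← hA ξ h hh h' hh' hJ α]
    change A ξ _ - gammaContraction (tensorS J cov) ξ _ = _
    rw [gammaContraction_apply, hp]
  rw [hY, thetaJ_d, omegaSt_apply, hp, hp, hp, hJ,
    mvfderiv_pairing_add_vertical hh α (hJd _), mvfderiv_pairing_add_vertical hk β (hJd _),
    mvfderiv_pairing_add_vertical hh' _ (diffVectorFieldAt_extend _),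
    mvfderiv_pairing_add_vertical hk β (diffVectorFieldAt_extend _), hJ]
  simp only [FiberBundle.extend_apply_self]
  change _ = (ξ.snd _ : ℝ) +
    ((α (J ξ.proj (dproj ξ k)) : ℝ) - (ξ.snd (tensorS J cov ξ.proj (dproj ξ h) (dproj ξ k)) : ℝ)) - _
  -- The terms `α(J dπ k)` and `β(J dπ h)` occur on both sides; what remains is the four-term
  -- formula for `S` paired with `ξ`.
  rw [tensorS_apply]
  simp only [map_sub, map_add]
  ring

/-- The witness that `Classical.epsilon` needs is `J^{G,∇} - γ(S)`. -/
lemma isCompleteLift_completeLift (J : AlmostComplexStructure n M) (cov : Connection n M) :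
    IsCompleteLift J (completeLift J) :=
  Classical.epsilon_spec ⟨_, (isGeneralizedHorizontalLift_generalizedHorizontalLift J
    cov).isCompleteLift_sub⟩

end CompleteLift

end CotangentLift

end

open CotangentLift in
theorem proposition2 {n : ℕ} {M : Type*} [TopologicalSpace M] [T2Space M]
    [ChartedSpace (Model n) M] [IsManifold (𝓡 n) ∞ M]
    (J : AlmostComplexStructure n M) (cov : Connection n M)
    [CovariantDerivative.ContMDiffCovariantDerivative cov ∞] :
    -- the defining properties of `J^{G,∇}` and of `J^c` each determine exactly one tensor field
    (∀ A : EndField n M,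
      IsGeneralizedHorizontalLift J cov A ↔ A = generalizedHorizontalLift J cov) ∧
    (∀ A : EndField n M, IsCompleteLift J A ↔ A = completeLift J) ∧
    -- the matrix of `J^{G,∇}` in the local coordinates of `T^* M` given by any chart `φ` of `M`
    (∀ φ ∈ IsManifold.maximalAtlas (𝓡 n) ∞ M, ∀ ξ : CotangentBundle n M, ξ.proj ∈ φ.source →
      Function.Bijective (components φ ξ) ∧
      ∀ Y : TT ξ, components φ ξ (generalizedHorizontalLift J cov ξ Y) =
        (localMatrix J cov φ ξ).mulVec (components φ ξ Y)) ∧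
    -- `J^{G,∇} = J^c + γ(S)`
    generalizedHorizontalLift J cov = completeLift J + gammaContraction (tensorS J cov) := by
  have hG := isGeneralizedHorizontalLift_generalizedHorizontalLift J cov
  have hC := isCompleteLift_completeLift J cov
  exact ⟨fun A => ⟨fun hA => hA.unique hG, fun hA => hA ▸ hG⟩,
    fun A => ⟨fun hA => hA.unique cov hC, fun hA => hA ▸ hC⟩,
    fun φ hφ ξ hξ => ⟨components_bijective cov hφ hξ, hG.components_apply hφ hξ⟩,
    sub_eq_iff_eq_add.1 (hG.isCompleteLift_sub.unique cov hC)⟩
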